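/- Let $n\ge 2$ and let $K_n$ be the complete graph on the vertex set $\{1,\ldots,n\}$, with Laplacian $\Delta\colon\mathbb{Z}^n\to\mathbb{Z}^n$. For $\mathbf d,\mathbf d'\in\mathbb{Z}^n$ write $\mathbf d\sim\mathbf d'$ if $\mathbf d-\mathbf d'\in\mathrm{Image}(\Delta)$, let $\mathcal N\subset\mathbb{Z}^n$ be the set of vectors that are not equivalent under $\sim$ to a vector with all coordinates nonnegative, and let the Baker--Norine rank of $K_n$ be $$r_{\rm BN}(\mathbf d)=-1+\min_{\mathbf d'\in\mathcal N}\sum_{j=1}^n|d_j-d'_j|,\qquad \mathbf d\in\mathbb{Z}^n.$$ Let $\mathbf e_1,\ldots,\mathbf e_n$ be the standard basis of $\mathbb{Z}^n$, and let $\mathfrak t_j$ be the operator $(\mathfrak t_j f)(\mathbf d)=f(\mathbf d-\mathbf e_j)$ on functions $f\colon\mathbb{Z}^n\to\mathbb{Z}$. For $i\in\mathbb{Z}$ let $$\mathcal A_{\deg i}=\{\mathbf a\in\mathbb{Z}^n \mid a_1,\ldots,a_{n-2}\in\{0,\ldots,n-1\},\ a_{n-1}=0,\ a_1+\cdots+a_n=i\}.$$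 Then for every $i\in\mathbb{Z}$ and every $\mathbf a\in\mathcal A_{\deg i}$, $$a_1+\cdots+a_{n-2}\le i\iff a_n\ge 0\iff r_{\rm BN}(\mathbf a)=r_{\rm BN}(\mathbf a-\mathbf e_{n-1})+1.$$ Moreover, for every $i\in\mathbb{Z}$ and every $\mathbf b\in\{0,\ldots,n-1\}^{n-2}$, writing $\langle\mathbf b,i\rangle=(b_1,\ldots,b_{n-2},0,i-b_1-\cdots-b_{n-2})\in\mathbb{Z}^n$, the value $\bigl((1-\mathfrak t_{n-1})r_{\rm BN}\bigr)(\langle\mathbf b,i\rangle)$ is $1$ if $b_1+\cdots+b_{n-2}\le i$ and $0$ otherwise. -/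

import Mathlib

namespace BakerNorine

section Graph

variable {V : Type*} [Fintype V] [DecidableEq V]

/-- The degree `∑ d_v` of an integer vector. -/
def deg (d : V → ℤ) : ℤ := ∑ v, d v

/-- `d ∼ d'`: the difference lies in the image of the Laplacian of `G` on `ℤ^V`. -/
def Equivalent (G : SimpleGraph V) [DecidableRel G.Adj] (d d' : V → ℤ) : Prop :=
  d - d' ∈ Set.range (fun x : V → ℤ => Matrix.mulVec (G.lapMatrix ℤ) x)

/-- The set `𝒩` of vectors that are not equivalent to an effective (i.e. nonnegative) vector. -/
def nonEffective (G : SimpleGraph V) [DecidableRel G.Adj] : Set (V → ℤ) :=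
  {d | ¬ ∃ d' : V → ℤ, 0 ≤ d' ∧ Equivalent G d d'}

/-- The `L¹` distance on `ℤ^V`. -/
def distL1 (d d' : V → ℤ) : ℤ := ∑ v, |d v - d' v|

/-- The `L¹` distance `min_{d' ∈ 𝒩} ‖d - d'‖` from `d` to `𝒩`
(a minimum by `isLeast_distNonEffective`). -/
noncomputable def distNonEffective (G : SimpleGraph V) [DecidableRel G.Adj] (d : V → ℤ) : ℤ :=
  sInf (distL1 d '' nonEffective G)

/-- The Baker-Norine rank. -/
noncomputable def rank (G : SimpleGraph V) [DecidableRel G.Adj] (d : V → ℤ) : ℤ :=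
  distNonEffective G d - 1

/-- The downward shift operator `(𝔱_i f)(d) = f(d - e_i)`. -/
def downShift (i : V) : Module.End ℤ ((V → ℤ) → ℤ) :=
  LinearMap.funLeft ℤ ℤ (fun d : V → ℤ => d - Pi.single i 1)

theorem deg_eq_of_equivalent (G : SimpleGraph V) [DecidableRel G.Adj] {d d' : V → ℤ}
    (h : Equivalent G d d') : deg d = deg d' := by
  obtain ⟨x, hx⟩ := h
  have h1 : Matrix.vecMul (fun _ : V => (1 : ℤ)) (G.lapMatrix ℤ) = 0 := by
    rw [← Matrix.mulVec_transpose, (G.isSymm_lapMatrix (R := ℤ)).eq]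
    exact G.lapMatrix_mulVec_const_eq_zero
  have h2 : dotProduct (fun _ : V => (1 : ℤ)) (d - d') = 0 := by
    rw [← hx, Matrix.dotProduct_mulVec, h1, zero_dotProduct]
  have h3 : ∑ v, (d v - d' v) = 0 := by simpa [dotProduct] using h2
  rw [Finset.sum_sub_distrib] at h3
  unfold deg
  linarith

theorem nonEffective_nonempty [Nonempty V] (G : SimpleGraph V) [DecidableRel G.Adj] :
    (nonEffective G).Nonempty := by
  refine ⟨fun _ => -1, ?_⟩
  rintro ⟨d', hd', he⟩
  have h := deg_eq_of_equivalent G he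
  have h0 : 0 ≤ deg d' := Finset.sum_nonneg fun v _ => hd' v
  have h1 : deg (fun _ : V => (-1 : ℤ)) < 0 :=
    Finset.sum_neg (fun _ _ => by norm_num) Finset.univ_nonempty
  omega

theorem isLeast_distNonEffective [Nonempty V] (G : SimpleGraph V) [DecidableRel G.Adj]
    (d : V → ℤ) : IsLeast (distL1 d '' nonEffective G) (distNonEffective G d) := by
  have hb : BddBelow (distL1 d '' nonEffective G) := by
    refine ⟨0, ?_⟩
    rintro _ ⟨d', _, rfl⟩
    exact Finset.sum_nonneg fun v _ => abs_nonneg _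
  exact ⟨Int.csInf_mem ((nonEffective_nonempty G).image _) hb, fun _ hx => csInf_le hb hx⟩

end Graph

section CompleteGraph

/-- The Baker-Norine rank `ℤ^n → ℤ` of the complete graph `K_n`. -/
noncomputable def rankK (n : ℕ) : (Fin n → ℤ) → ℤ := rank (⊤ : SimpleGraph (Fin n))

/-- The coordinate with (one-based) number `j`, for `1 ≤ j ≤ n - 2`; here `j - 1 : Fin (n - 2)`. -/
def front {n : ℕ} (j : Fin (n - 2)) : Fin n := Fin.castLE (Nat.sub_le n 2) j

/-- The coordinate with (one-based) number `n - 1`. -/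
def penult {n : ℕ} (hn : 2 ≤ n) : Fin n := ⟨n - 2, by omega⟩

/-- The coordinate with (one-based) number `n`. -/
def final {n : ℕ} (hn : 2 ≤ n) : Fin n := ⟨n - 1, by omega⟩

/-- The set `𝒜_{deg i}`: vectors of degree `i` with `a_1, …, a_{n-2} ∈ {0, …, n-1}` and
`a_{n-1} = 0`. -/
def cADeg {n : ℕ} (hn : 2 ≤ n) (i : ℤ) : Set (Fin n → ℤ) :=
  {a | (∀ j : Fin (n - 2), a (front j) ∈ Set.Icc (0 : ℤ) (n - 1)) ∧
    a (penult hn) = 0 ∧ deg a = i}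

/-- The set `ℬ = {0, …, n-1}^{n-2}`. -/
def cB (n : ℕ) : Set (Fin (n - 2) → ℤ) :=
  {b | ∀ j, b j ∈ Set.Icc (0 : ℤ) (n - 1)}

/-- The vector `⟨b, i⟩ = (b_1, …, b_{n-2}, 0, i - b_1 - ⋯ - b_{n-2})`. -/
def bracket {n : ℕ} (b : Fin (n - 2) → ℤ) (i : ℤ) : Fin n → ℤ := fun j =>
  if h : j.val < n - 2 then b ⟨j.val, h⟩
  else if j.val = n - 2 then 0
  else i - ∑ k, b k

end CompleteGraph

end BakerNorine

namespace BakerNorine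

variable {n : ℕ}

/-! A vector on `K_n` is non-effective iff it lies below an extremal vector
(`mem_nonEffective_of_le`, `exists_le_of_mem_nonEffective`), so its distance to `𝒩` is its least
excess over extremal vectors (`isLeast_excess`). Lowering `d` at `v` lowers the excess over `ν`
exactly when `ν v < d v`; here `d v = 0`, so what matters is the sign of `ν v` at a minimiser.

If `d ≥ 0`, every `ν` has a negative entry by its degree, and swapping it into `v` costs nothing:
the rank drops. If `d w < 0` at the last coordinate `w`, the front entries being at most `n - 1`, an
exchange strictly improves every `ν` with `ν v < 0`: the rank stays. -/

/-- Integer vectors whose entries are pairwise incongruent modulo `n` and whose degree is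
`n (n - 3) / 2`. For `n ≥ 1` these are the maximal non-effective vectors of `K_n`. -/
def extremal (n : ℕ) : Set (Fin n → ℤ) :=
  {ν | Function.Injective (fun j => ν j % (n : ℤ)) ∧ 2 * ∑ j, ν j = n * (n - 3)}

/-- The degree of the positive part of `d - ν`. -/
def excess (d ν : Fin n → ℤ) : ℤ := ∑ j, max (d j - ν j) 0

/-! ### Sums of complete residue systems -/

theorem two_mul_sum_emod_of_injective {ν : Fin n → ℤ}
    (h : Function.Injective (fun j => ν j % (n : ℤ))) :
    2 * ∑ j, ν j % (n : ℤ) = n * (n - 1) := by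
  rcases Nat.eq_zero_or_pos n with rfl | hn
  · simp
  have hn' : (0 : ℤ) < n := by exact_mod_cast hn
  have hlt : ∀ j, (ν j % (n : ℤ)).toNat < n := fun j => by
    have := Int.emod_lt_of_pos (ν j) hn'
    have := Int.emod_nonneg (ν j) hn'.ne'
    omega
  let g : Fin n → Fin n := fun j => ⟨(ν j % (n : ℤ)).toNat, hlt j⟩
  have hg : Function.Injective g := fun a b hab => h <| by
    have h1 : (ν a % (n : ℤ)).toNat = (ν b % (n : ℤ)).toNat := congrArg Fin.val hab
    have := Int.emod_nonneg (ν a) hn'.ne'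
    have := Int.emod_nonneg (ν b) hn'.ne'
    change ν a % (n : ℤ) = ν b % (n : ℤ)
    omega
  have h1 : ∑ j, ν j % (n : ℤ) = ∑ j : Fin n, ((j : ℕ) : ℤ) := by
    rw [← (Equiv.ofBijective g (Finite.injective_iff_bijective.1 hg)).sum_comp
      (fun k : Fin n => ((k : ℕ) : ℤ))]
    refine Finset.sum_congr rfl fun j _ => ?_
    simp [g, Int.emod_nonneg (ν j) hn'.ne']
  rw [h1, Fin.sum_univ_eq_sum_range (fun k => (k : ℤ))]
  have h2 := Finset.sum_range_id_mul_two n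
  zify [hn] at h2
  linarith

theorem le_two_mul_sum_of_injective {ν : Fin n → ℤ}
    (h : Function.Injective (fun j => ν j % (n : ℤ))) (h0 : ∀ j, 0 ≤ ν j) :
    (n : ℤ) * (n - 1) ≤ 2 * ∑ j, ν j := by
  rw [← two_mul_sum_emod_of_injective h]
  have : ∑ j, ν j % (n : ℤ) ≤ ∑ j, ν j := Finset.sum_le_sum fun j _ => by
    have h1 := Int.emod_add_mul_ediv (ν j) n
    have h2 := mul_nonneg (Int.natCast_nonneg n) (Int.ediv_nonneg (h0 j) (Int.natCast_nonneg n))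
    linarith
  linarith

theorem injective_emod_congr {ν ν' : Fin n → ℤ} {c : ℤ} (h : ∀ j, (n : ℤ) ∣ ν' j - ν j - c)
    (hν : Function.Injective (fun j => ν j % (n : ℤ))) :
    Function.Injective (fun j => ν' j % (n : ℤ)) := fun a b hab => hν <| by
  have hab' : (n : ℤ) ∣ ν' b - ν' a := (show ν' a ≡ ν' b [ZMOD n] from hab).dvd
  have : (n : ℤ) ∣ ν b - ν a := by
    have := (hab'.add (h a)).sub (h b)
    obtain ⟨k, hk⟩ := this
    exact ⟨k, by linarith⟩
  exact Int.modEq_iff_dvd.2 this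

theorem sum_le_of_injective {ν : Fin n → ℤ}
    (h : Function.Injective (fun j => ν j % (n : ℤ))) (h0 : ∀ j, ν j ≤ n - 1) :
    2 * ∑ j, ν j ≤ (n : ℤ) * (n - 1) := by
  have hinj : Function.Injective (fun j => ((n : ℤ) - 1 - ν j) % (n : ℤ)) := fun a b hab => h <| by
    have := (show (n : ℤ) - 1 - ν a ≡ n - 1 - ν b [ZMOD n] from hab).symm.dvd
    refine Int.modEq_iff_dvd.2 ?_
    obtain ⟨k, hk⟩ := this
    exact ⟨k, by linarith⟩
  have := le_two_mul_sum_of_injective hinj fun j => by linarith [h0 j]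
  simp only [Finset.sum_sub_distrib, Finset.sum_const, Finset.card_univ, Fintype.card_fin,
    nsmul_eq_mul] at this
  linarith

/-! ### Non-effective vectors of the complete graph -/

theorem lapMatrix_top_mulVec (x : Fin n → ℤ) (v : Fin n) :
    Matrix.mulVec ((⊤ : SimpleGraph (Fin n)).lapMatrix ℤ) x v = n * x v - ∑ u, x u := by
  have hn : 1 ≤ n := v.pos
  rw [SimpleGraph.lapMatrix_mulVec_apply, SimpleGraph.complete_graph_degree]
  have : (⊤ : SimpleGraph (Fin n)).neighborFinset v = Finset.univ.erase v := by
    ext u; simp [eq_comm]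
  rw [this, ← Finset.add_sum_erase Finset.univ x (Finset.mem_univ v)]
  simp only [Fintype.card_fin]
  push_cast [hn]
  ring

theorem equivalent_top_iff {d d' : Fin n → ℤ} :
    Equivalent (⊤ : SimpleGraph (Fin n)) d d' ↔
      ∃ x : Fin n → ℤ, ∀ j, d j - d' j = n * x j - ∑ u, x u := by
  constructor
  · rintro ⟨x, hx⟩
    refine ⟨x, fun j => ?_⟩
    rw [← lapMatrix_top_mulVec, ← Pi.sub_apply, ← hx]
  · rintro ⟨x, hx⟩
    exact ⟨x, funext fun j => by simpa [lapMatrix_top_mulVec] using (hx j).symm⟩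

/-- If `d ∼ e ≥ 0`, then `ν + (e - d)` is nonnegative with the degree of `ν`. Its entries stay
incongruent, since the Laplacian of `K_n` is constant modulo `n`; but then its degree is too small.
-/
theorem mem_nonEffective_of_le {d ν : Fin n → ℤ} (hn : 0 < n) (hν : ν ∈ extremal n)
    (h : ∀ j, d j ≤ ν j) : d ∈ nonEffective (⊤ : SimpleGraph (Fin n)) := by
  rintro ⟨e, he, hde⟩
  obtain ⟨x, hx⟩ := equivalent_top_iff.1 hde
  let μ : Fin n → ℤ := fun j => e j + (ν j - d j)
  have hμ : ∀ j, μ j = ν j - (n * x j - ∑ u, x u) := fun j => by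
    simp only [μ]; linarith [hx j]
  have hinj : Function.Injective (fun j => μ j % (n : ℤ)) := by
    refine injective_emod_congr (c := ∑ u, x u) (fun j => ⟨-x j, ?_⟩) hν.1
    rw [hμ]; ring
  have h1 := le_two_mul_sum_of_injective hinj fun j => by
    have := he j
    have := h j
    simp only [Pi.zero_apply] at *
    simp only [μ]; linarith
  have h2 : ∑ j, μ j = ∑ j, ν j := by
    simp only [hμ, Finset.sum_sub_distrib, ← Finset.mul_sum, Finset.sum_const, Finset.card_univ,
      Fintype.card_fin, nsmul_eq_mul]
    ring
  rw [h2, hν.2] at h1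
  have : (0 : ℤ) < n := by exact_mod_cast hn
  linarith

/-- Firing `x` of total `s` leaves `d j + s - n * x j`, nonnegative iff `x j` is at most the
quotient. If the quotients sum to at least `s`, removing the surplus at one vertex gives such an
`x`. -/
theorem sum_ediv_lt_of_mem_nonEffective {d : Fin n → ℤ} (hn : 0 < n)
    (h : d ∈ nonEffective (⊤ : SimpleGraph (Fin n))) (s : ℤ) :
    ∑ j, (d j + s) / (n : ℤ) < s := by
  by_contra! hs
  have hn' : (0 : ℤ) < n := by exact_mod_cast hn
  set T := ∑ j, (d j + s) / (n : ℤ) with hT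
  let x : Fin n → ℤ := fun j =>
    (d j + s) / (n : ℤ) - (Pi.single ⟨0, hn⟩ (T - s) : Fin n → ℤ) j
  have hx : ∑ j, x j = s := by
    simp only [x, Finset.sum_sub_distrib, ← hT, Finset.sum_pi_single', Finset.mem_univ, if_true]
    ring
  refine h ⟨fun j => d j + s - n * x j, fun j => ?_, equivalent_top_iff.2 ⟨x, fun j => ?_⟩⟩
  · have h1 : (n : ℤ) * ((d j + s) / (n : ℤ)) ≤ d j + s := Int.mul_ediv_self_le hn'.ne'
    have h2 : 0 ≤ (Pi.single (⟨0, hn⟩ : Fin n) (T - s) : Fin n → ℤ) j := by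
      by_cases hj : j = ⟨0, hn⟩
      · subst hj; simpa using hs
      · simp [hj]
    have h3 := mul_nonneg hn'.le h2
    simp only [Pi.zero_apply, x, mul_sub]
    linarith
  · rw [hx]; ring

theorem exists_le_of_mem_nonEffective {d : Fin n → ℤ} (hn : 0 < n)
    (h : d ∈ nonEffective (⊤ : SimpleGraph (Fin n))) :
    ∃ ν ∈ extremal n, ∀ j, d j ≤ ν j := by
  have hn' : (0 : ℤ) < n := by exact_mod_cast hn
  let r : Fin n → ℤ := fun j => d j % (n : ℤ)
  let q : Fin n → ℤ := fun j => d j / (n : ℤ)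
  have hd : ∀ j, d j = r j + n * q j := fun j => (Int.emod_add_mul_ediv (d j) n).symm
  have hr0 : ∀ j, 0 ≤ r j := fun j => Int.emod_nonneg _ hn'.ne'
  have hrn : ∀ j, r j < n := fun j => Int.emod_lt_of_pos _ hn'
  let σ := Tuple.sort r
  have hσ : Monotone (r ∘ σ) := Tuple.monotone_sort r
  set Q := ∑ j, q j with hQ
  -- Residues are replaced by their positions in sorted order; the shift `-1 - Q` fixes the degree.
  let ν : Fin n → ℤ := fun j => n * q j + ((σ.symm j : ℕ) - 1 - Q)
  refine ⟨ν, ⟨fun a b hab => ?_, ?_⟩, fun j => ?_⟩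
  · have h1 : (n : ℤ) ∣ ν b - ν a := (show ν a ≡ ν b [ZMOD n] from hab).dvd
    have h2 : (n : ℤ) ∣ ((σ.symm b : ℕ) : ℤ) - (σ.symm a : ℕ) := by
      have := h1.sub (dvd_mul_right (n : ℤ) (q b - q a))
      obtain ⟨k, hk⟩ := this
      refine ⟨k, ?_⟩
      simp only [ν] at hk
      linarith
    have h3 : ((σ.symm a : ℕ) : ℤ) = (σ.symm b : ℕ) := by
      have := Int.modEq_iff_dvd.2 h2
      rwa [Int.ModEq, Int.emod_eq_of_lt (by positivity) (by exact_mod_cast (σ.symm a).2),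
        Int.emod_eq_of_lt (by positivity) (by exact_mod_cast (σ.symm b).2)] at this
    exact σ.symm.injective (Fin.ext (by exact_mod_cast h3))
  · have h1 : ∑ j, ((σ.symm j : ℕ) : ℤ) = ∑ j : Fin n, ((j : ℕ) : ℤ) :=
      σ.symm.sum_comp (fun j : Fin n => ((j : ℕ) : ℤ))
    have h2 := Finset.sum_range_id_mul_two n
    zify [hn] at h2
    rw [← Fin.sum_univ_eq_sum_range (fun k => (k : ℤ))] at h2
    simp only [ν, Finset.sum_add_distrib, Finset.sum_sub_distrib, ← Finset.mul_sum, ← hQ, h1,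
      Finset.sum_const, Finset.card_univ, Fintype.card_fin, nsmul_eq_mul]
    linarith
  · obtain ⟨i, rfl⟩ := σ.surjective j
    -- This `s` raises the quotient by one at every position `k ≥ i`, so `Q + (n - i) < n - r (σ
    -- i)`.
    have h1 := sum_ediv_lt_of_mem_nonEffective hn h (n - r (σ i))
    have h2 : ∀ k, q (σ k) + (if i ≤ k then 1 else 0) ≤ (d (σ k) + (n - r (σ i))) / (n : ℤ) := by
      intro k
      rw [Int.le_ediv_iff_mul_le hn', hd (σ k)]
      split_ifs with hik
      · have : r (σ i) ≤ r (σ k) := hσ hik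
        linarith
      · linarith [hrn (σ i), hr0 (σ k)]
    have h3 := Finset.sum_le_sum fun k (_ : k ∈ Finset.univ) => h2 k
    rw [Equiv.sum_comp σ (fun k => (d k + (n - r (σ i))) / (n : ℤ)), Finset.sum_add_distrib,
      Equiv.sum_comp σ q, ← hQ, Finset.sum_boole] at h3
    have h4 : (Finset.univ.filter fun k => i ≤ k).card = n - (i : ℕ) := by
      rw [show (Finset.univ.filter fun k => i ≤ k) = Finset.Ici i by ext; simp, Fin.card_Ici]
    rw [h4] at h3
    have := i.2
    push_cast [this.le] at h3
    simp only [ν, Equiv.symm_apply_apply]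
    linarith [hd (σ i)]

/-- The point below `ν` nearest to `d` is `min d ν`, at distance `excess d ν`. -/
theorem isLeast_excess (hn : 0 < n) (d : Fin n → ℤ) :
    IsLeast (excess d '' extremal n) (distNonEffective (⊤ : SimpleGraph (Fin n)) d) := by
  have : Nonempty (Fin n) := ⟨⟨0, hn⟩⟩
  have hleast := isLeast_distNonEffective (⊤ : SimpleGraph (Fin n)) d
  have hle : ∀ ν ∈ extremal n, distNonEffective (⊤ : SimpleGraph (Fin n)) d ≤ excess d ν := by
    intro ν hν
    refine hleast.2 ⟨fun j => min (d j) (ν j),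
      mem_nonEffective_of_le hn hν fun j => min_le_right _ _, ?_⟩
    refine Finset.sum_congr rfl fun j _ => ?_
    grind
  refine ⟨?_, by rintro _ ⟨ν, hν, rfl⟩; exact hle ν hν⟩
  obtain ⟨d', hd', h⟩ := hleast.1
  obtain ⟨ν, hν, hdν⟩ := exists_le_of_mem_nonEffective hn hd'
  refine ⟨ν, hν, le_antisymm ?_ (hle ν hν)⟩
  rw [← h]
  refine Finset.sum_le_sum fun j _ => max_le ?_ (abs_nonneg _)
  exact (sub_le_sub_left (hdν j) _).trans (le_abs_self _)

/-! ### Lowering one coordinate -/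

theorem excess_sub_single (d ν : Fin n → ℤ) (v : Fin n) :
    excess (d - Pi.single v 1) ν = excess d ν - if ν v < d v then 1 else 0 := by
  rw [excess, excess, ← Finset.add_sum_erase _ _ (Finset.mem_univ v),
    ← Finset.add_sum_erase _ (fun j => max (d j - ν j) 0) (Finset.mem_univ v)]
  have : ∑ j ∈ Finset.univ.erase v, max ((d - Pi.single v 1 : Fin n → ℤ) j - ν j) 0 =
      ∑ j ∈ Finset.univ.erase v, max (d j - ν j) 0 :=
    Finset.sum_congr rfl fun j hj => by simp [Finset.ne_of_mem_erase hj]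
  rw [this]
  simp only [Pi.sub_apply, Pi.single_eq_same]
  split_ifs <;> grind

/-- Lowering the coordinate `v` of `d` lowers the rank when the excess of `d` is minimised by a
vector that is smaller than `d` at `v`. -/
theorem rankK_eq_add_one {d : Fin n → ℤ} {v : Fin n}
    (h : ∀ ν ∈ extremal n, d v ≤ ν v →
      ∃ ν' ∈ extremal n, ν' v < d v ∧ excess d ν' ≤ excess d ν) :
    rankK n d = rankK n (d - Pi.single v 1) + 1 := by
  obtain ⟨⟨ν, hν, h1⟩, h2⟩ := isLeast_excess v.pos d
  obtain ⟨⟨μ, hμ, h3⟩, h4⟩ := isLeast_excess v.pos (d - Pi.single v 1)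
  have h5 := h2 ⟨μ, hμ, rfl⟩
  rw [excess_sub_single] at h3
  suffices distNonEffective (⊤ : SimpleGraph (Fin n)) (d - Pi.single v 1) ≤ excess d ν - 1 by
    simp only [rankK, rank]
    split_ifs at h3 <;> linarith
  rcases lt_or_ge (ν v) (d v) with hv | hv
  · have := h4 ⟨ν, hν, rfl⟩
    rwa [excess_sub_single, if_pos hv] at this
  · obtain ⟨ν', hν', hv', hle⟩ := h ν hν hv
    have := h4 ⟨ν', hν', rfl⟩
    rw [excess_sub_single, if_pos hv'] at this
    linarith

/-- If a minimiser for `d - e_v` is smaller than `d` at `v`, its excess for `d` is one larger; the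
strict improvement regains that one. -/
theorem rankK_eq {d : Fin n → ℤ} {v : Fin n}
    (h : ∀ ν ∈ extremal n, ν v < d v → ∃ ν' ∈ extremal n, excess d ν' < excess d ν) :
    rankK n d = rankK n (d - Pi.single v 1) := by
  obtain ⟨⟨ν, hν, h1⟩, h2⟩ := isLeast_excess v.pos d
  obtain ⟨⟨μ, hμ, h3⟩, h4⟩ := isLeast_excess v.pos (d - Pi.single v 1)
  have h5 := h4 ⟨ν, hν, rfl⟩
  have h6 := h2 ⟨μ, hμ, rfl⟩
  rw [excess_sub_single] at h3 h5
  simp only [rankK, rank]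
  split_ifs at h3 with hv
  · obtain ⟨ν', hν', hlt⟩ := h μ hμ hv
    have := h2 ⟨ν', hν', rfl⟩
    split_ifs at h5 <;> linarith
  · split_ifs at h5 <;> linarith

/-! ### Exchanges between extremal vectors -/

/-- Exchange the entries at `u` and `v` and move `c` from `v` to `u`. -/
def exchange (ν : Fin n → ℤ) (u v : Fin n) (c : ℤ) : Fin n → ℤ :=
  ν ∘ Equiv.swap u v + Pi.single u c - Pi.single v c

theorem exchange_mem_extremal {ν : Fin n → ℤ} (hν : ν ∈ extremal n) (u v : Fin n) {c : ℤ}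
    (hc : (n : ℤ) ∣ c) : exchange ν u v c ∈ extremal n := by
  refine ⟨injective_emod_congr (ν := ν ∘ Equiv.swap u v) (c := 0) (fun j => ?_)
    (hν.1.comp (Equiv.swap u v).injective), ?_⟩
  · have hs : ∀ w : Fin n, (n : ℤ) ∣ (Pi.single w c : Fin n → ℤ) j := fun w => by
      by_cases hj : j = w
      · subst hj; simpa using hc
      · simp [hj]
    have := (hs u).sub (hs v)
    obtain ⟨k, hk⟩ := this
    refine ⟨k, ?_⟩
    simp only [exchange, Pi.sub_apply, Pi.add_apply]
    linarith
  · rw [← hν.2, ← Equiv.sum_comp (Equiv.swap u v) ν]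
    simp [exchange, Finset.sum_sub_distrib, Finset.sum_add_distrib]

theorem excess_exchange {ν : Fin n → ℤ} {u v : Fin n} (huv : u ≠ v) (d : Fin n → ℤ) (c : ℤ) :
    excess d (exchange ν u v c) + (max (d u - ν u) 0 + max (d v - ν v) 0) =
      excess d ν + (max (d u - (ν v + c)) 0 + max (d v - (ν u - c)) 0) := by
  have hsplit : ∀ μ : Fin n → ℤ, excess d μ = max (d u - μ u) 0 + (max (d v - μ v) 0 +
      ∑ j ∈ (Finset.univ.erase u).erase v, max (d j - μ j) 0) := fun μ => by
    rw [excess, ← Finset.add_sum_erase _ _ (Finset.mem_univ u),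
      ← Finset.add_sum_erase _ _ (Finset.mem_erase.2 ⟨huv.symm, Finset.mem_univ v⟩)]
  have hrest : ∑ j ∈ (Finset.univ.erase u).erase v, max (d j - exchange ν u v c j) 0 =
      ∑ j ∈ (Finset.univ.erase u).erase v, max (d j - ν j) 0 :=
    Finset.sum_congr rfl fun j hj => by
      simp only [Finset.mem_erase] at hj
      simp [exchange, hj.1, hj.2.1, Equiv.swap_apply_of_ne_of_ne hj.2.1 hj.1]
  have hu : exchange ν u v c u = ν v + c := by simp [exchange, huv]
  have hv : exchange ν u v c v = ν u - c := by simp [exchange, huv.symm]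
  rw [hsplit, hsplit ν, hrest, hu, hv]
  ring

theorem exists_neg_of_mem_extremal {ν : Fin n → ℤ} (hn : 0 < n) (hν : ν ∈ extremal n) :
    ∃ u, ν u < 0 := by
  by_contra! h
  have h1 := le_two_mul_sum_of_injective hν.1 h
  rw [hν.2] at h1
  have : (0 : ℤ) < n := by exact_mod_cast hn
  linarith

theorem rankK_eq_add_one_of_nonneg {d : Fin n → ℤ} {v : Fin n} (hd : ∀ j, 0 ≤ d j)
    (hv : d v = 0) : rankK n d = rankK n (d - Pi.single v 1) + 1 := by
  refine rankK_eq_add_one fun ν hν hνv => ?_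
  obtain ⟨u, hu⟩ := exists_neg_of_mem_extremal v.pos hν
  have huv : u ≠ v := by rintro rfl; omega
  refine ⟨exchange ν u v 0, exchange_mem_extremal hν u v (dvd_zero _), ?_, ?_⟩
  · simpa [exchange, huv, hv] using hu
  · have := excess_exchange (ν := ν) huv d 0
    have := hd u
    grind

/-- Otherwise adding `n` at `v` and at `w` keeps the residues and leaves all entries at most `n -
1`, yet twice the sum becomes `n * (n + 1) > n * (n - 1)`. -/
theorem exists_large_of_mem_extremal {ν : Fin n → ℤ} (hν : ν ∈ extremal n) {v w : Fin n}
    (hvw : v ≠ w) (hv : ν v < 0) : 0 ≤ ν w ∨ ∃ u, u ≠ v ∧ u ≠ w ∧ (n : ℤ) ≤ ν u := by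
  by_contra! h
  have hn' : (0 : ℤ) < n := by exact_mod_cast v.pos
  let μ : Fin n → ℤ := ν + Pi.single v (n : ℤ) + Pi.single w (n : ℤ)
  have hinj : Function.Injective (fun j => μ j % (n : ℤ)) := by
    refine injective_emod_congr (c := 0) (fun j => ?_) hν.1
    have hs : ∀ k : Fin n, (n : ℤ) ∣ (Pi.single k (n : ℤ) : Fin n → ℤ) j := fun k => by
      by_cases hj : j = k
      · subst hj; simp
      · simp [hj]
    have := (hs v).add (hs w)
    obtain ⟨k, hk⟩ := this
    refine ⟨k, ?_⟩
    simp only [μ, Pi.add_apply]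
    linarith
  have h1 := sum_le_of_injective hinj fun j => by
    by_cases hjv : j = v
    · subst hjv; simp [μ, hvw]; omega
    by_cases hjw : j = w
    · subst hjw; simp [μ, hjv]; omega
    have := h.2 j hjv hjw
    simp [μ, hjv, hjw]; omega
  have h2 : ∑ j, μ j = ∑ j, ν j + n + n := by
    simp [μ, Finset.sum_add_distrib]
  rw [h2] at h1
  have := hν.2
  linarith

theorem rankK_eq_of_neg {d : Fin n → ℤ} {v w : Fin n} (hv : d v = 0) (hw : d w < 0)
    (hd : ∀ j, j ≠ v → j ≠ w → d j ≤ n - 1) : rankK n d = rankK n (d - Pi.single v 1) := by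
  have hvw : v ≠ w := by rintro rfl; omega
  refine rankK_eq fun ν hν hνv => ?_
  rw [hv] at hνv
  obtain h | ⟨u, huv, huw, hu⟩ := exists_large_of_mem_extremal hν hvw hνv
  · refine ⟨exchange ν w v 0, exchange_mem_extremal hν w v (dvd_zero _), ?_⟩
    have := excess_exchange (ν := ν) hvw.symm d 0
    grind
  -- Now `v` receives `ν u - n ≥ 0` and contributes nothing, while `d u < n` keeps the contribution
  -- of `u` below `-ν v`.
  · refine ⟨exchange ν u v n, exchange_mem_extremal hν u v dvd_rfl, ?_⟩
    have := excess_exchange (ν := ν) huv d n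
    have := hd u huv huw
    grind

/-! ### Specialisation to the vectors of `𝒜` -/

theorem eq_front_or_penult_or_final (hn : 2 ≤ n) (u : Fin n) :
    (∃ j, u = front j) ∨ u = penult hn ∨ u = final hn := by
  by_cases h : u.val < n - 2
  · exact Or.inl ⟨⟨u, h⟩, rfl⟩
  · have := u.2
    simp only [penult, final, Fin.ext_iff]
    omega

theorem deg_eq_front_add (hn : 2 ≤ n) (a : Fin n → ℤ) :
    deg a = ∑ j : Fin (n - 2), a (front j) + a (penult hn) + a (final hn) := by
  obtain ⟨m, rfl⟩ := Nat.exists_eq_add_of_le' hn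
  rw [deg, Fin.sum_univ_castSucc, Fin.sum_univ_castSucc]
  rfl

theorem rankK_of_final_nonneg (hn : 2 ≤ n) {i : ℤ} {a : Fin n → ℤ} (ha : a ∈ cADeg hn i)
    (h : 0 ≤ a (final hn)) :
    rankK n a = rankK n (a - Pi.single (penult hn) 1) + 1 := by
  refine rankK_eq_add_one_of_nonneg (fun j => ?_) ha.2.1
  obtain ⟨j, rfl⟩ | rfl | rfl := eq_front_or_penult_or_final hn j
  exacts [(ha.1 j).1, ha.2.1.ge, h]

theorem rankK_of_final_neg (hn : 2 ≤ n) {i : ℤ} {a : Fin n → ℤ} (ha : a ∈ cADeg hn i)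
    (h : a (final hn) < 0) :
    rankK n a = rankK n (a - Pi.single (penult hn) 1) := by
  refine rankK_eq_of_neg ha.2.1 h fun j h1 h2 => ?_
  obtain ⟨j, rfl⟩ | rfl | rfl := eq_front_or_penult_or_final hn j
  exacts [(ha.1 j).2, absurd rfl h1, absurd rfl h2]

theorem bracket_front (b : Fin (n - 2) → ℤ) (i : ℤ) (j : Fin (n - 2)) :
    bracket b i (front j) = b j := by
  simp [bracket, front]

theorem bracket_mem_cADeg (hn : 2 ≤ n) {b : Fin (n - 2) → ℤ} (hb : b ∈ cB n) (i : ℤ) :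
    bracket b i ∈ cADeg hn i := by
  have h1 : bracket b i (penult hn) = 0 := by simp [bracket, penult]
  have h2 : bracket b i (final hn) = i - ∑ k, b k := by
    have h3 : ¬ n - 1 < n - 2 := by omega
    have h4 : ¬ n - 1 = n - 2 := by omega
    simp [bracket, final, h3, h4]
  refine ⟨fun j => by rw [bracket_front]; exact hb j, h1, ?_⟩
  simp only [deg_eq_front_add hn, bracket_front, h1, h2]
  ring

theorem sum_front_le_iff (hn : 2 ≤ n) {i : ℤ} {a : Fin n → ℤ} (ha : a ∈ cADeg hn i) :
    ∑ j : Fin (n - 2), a (front j) ≤ i ↔ 0 ≤ a (final hn) := by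
  have h := deg_eq_front_add hn a
  rw [ha.2.1, ha.2.2] at h
  constructor <;> intro <;> linarith

end BakerNorine

theorem mainTheorem3 (n : ℕ) (hn : 2 ≤ n) (i : ℤ) :
    (∀ a ∈ BakerNorine.cADeg hn i,
      (∑ j : Fin (n - 2), a (BakerNorine.front j) ≤ i ↔ 0 ≤ a (BakerNorine.final hn)) ∧
      (0 ≤ a (BakerNorine.final hn) ↔
        BakerNorine.rankK n a =
          BakerNorine.rankK n (a - Pi.single (BakerNorine.penult hn) 1) + 1)) ∧
    (∀ b ∈ BakerNorine.cB n,
      (1 - BakerNorine.downShift (BakerNorine.penult hn)) (BakerNorine.rankK n)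
          (BakerNorine.bracket b i) =
        if ∑ j, b j ≤ i then 1 else 0) := by
  refine ⟨fun a ha => ⟨BakerNorine.sum_front_le_iff hn ha,
    BakerNorine.rankK_of_final_nonneg hn ha, fun h => ?_⟩, fun b hb => ?_⟩
  · by_contra! hlt
    have := BakerNorine.rankK_of_final_neg hn ha hlt
    omega
  · have ha := BakerNorine.bracket_mem_cADeg hn hb i
    have hiff := BakerNorine.sum_front_le_iff hn ha
    simp only [BakerNorine.bracket_front] at hiff
    change BakerNorine.rankK n (BakerNorine.bracket b i) - BakerNorine.rankK n
      (BakerNorine.bracket b i - Pi.single (BakerNorine.penult hn) 1) = _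
    split_ifs with h
    · rw [BakerNorine.rankK_of_final_nonneg hn ha (hiff.1 h)]
      ring
    · rw [BakerNorine.rankK_of_final_neg hn ha (not_le.1 fun h' => h (hiff.2 h'))]
      ring
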